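/- Define five sequences of positive integers $(A_n),(B_n),(C_n),(D_n),(E_n)$, indexed by $n\ge 1$, recursively as follows. For a finite set $S$ of positive integers let $\operatorname{mex}(S)$ be the least positive integer not in $S$, and let $S_n=\{A_i,B_i,C_i,D_i,E_i : 1\le i<n\}$ (so $S_1=\emptyset$). Put $$A_n=\operatorname{mex}(S_n),\quad B_n=\operatorname{mex}(S_n\cup\{A_n\}),\quad C_n=\operatorname{mex}(S_n\cup\{A_n,B_n\}),\quad D_n=\operatorname{mex}(S_n\cup\{A_n,B_n,C_n\}),$$ $$E_n=A_n+B_n+C_n+D_n .$$ (The $E_n$ are the anti-Tetranacci numbers, OEIS A299409.) Then: 1. The five sequences are complementary: every positive integer occurs in exactly one of them, at exactly one index. 2. For all $n\ge 1$, $$\begin{array}{rcl} 0\le& 17n-11-4A_n&\le 4,\\ 0\le& 17n-7-4B_n&\le 4,\\ 0\le& 17n-3-4C_n&\le 4,\\ 0\le& 17n+1-4D_n&\le 3,\\ 0\le& 17n-5-E_n&\le 3. \end{array}$$ Moreover $17n-3-4C_n=4$ for some $n\ge 1$, so that the bound $4$ in the third line cannot be replaced by $3$. 3. Each of the five remainder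 sequences $17n-11-4A_n$, $17n-7-4B_n$, $17n-3-4C_n$, $17n+1-4D_n$, $17n-5-E_n$, regarded as a sequence in $n-1=0,1,2,\dots$, is $2$-automatic: there is a finite automaton with output which, on reading any binary representation of $n-1$ (least significant digit first, zeros at the most significant end being allowed), outputs the term with index $n$. -/

import Mathlib

/-- The minimal excluded value of a finite set of positive integers: the least positive integer
that does not belong to `S`. -/
def mex (S : Finset ℕ) : ℕ :=
  Nat.find (p := fun m => 0 < m ∧ m ∉ S)
    ⟨S.sup id + 1, Nat.succ_pos _, fun h => by
      have h1 : S.sup id + 1 ≤ S.sup id := Finset.le_sup (f := id) h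
      omega⟩

namespace AntiTetranacci

/-- The next term of the first sequence, when `S` is the set of the terms used so far. -/
def nextA (S : Finset ℕ) : ℕ := mex S

/-- The next term of the second sequence. -/
def nextB (S : Finset ℕ) : ℕ := mex (S ∪ {nextA S})

/-- The next term of the third sequence. -/
def nextC (S : Finset ℕ) : ℕ := mex (S ∪ {nextA S, nextB S})

/-- The next term of the fourth sequence. -/
def nextD (S : Finset ℕ) : ℕ := mex (S ∪ {nextA S, nextB S, nextC S})

/-- The next term of the fifth sequence. -/
def nextE (S : Finset ℕ) : ℕ := nextA S + nextB S + nextC S + nextD S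

/-- The set of the terms with index `1, …, n` of all five sequences
(see `used_eq` below). -/
def used : ℕ → Finset ℕ
  | 0 => ∅
  | n + 1 => used n ∪
      {nextA (used n), nextB (used n), nextC (used n), nextD (used n), nextE (used n)}

/-! The five sequences are indexed by `n ≥ 1`; their values at `n = 0` have no meaning. -/

/-- `A n` is the mex of all terms with index `< n`. -/
def A (n : ℕ) : ℕ := nextA (used (n - 1))

/-- `B n` is the mex of all terms with index `< n` together with `A n`. -/
def B (n : ℕ) : ℕ := nextB (used (n - 1))

/-- `C n` is the mex of all terms with index `< n` together with `A n` and `B n`. -/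
def C (n : ℕ) : ℕ := nextC (used (n - 1))

/-- `D n` is the mex of all terms with index `< n` together with `A n`, `B n` and `C n`. -/
def D (n : ℕ) : ℕ := nextD (used (n - 1))

/-- The anti-Tetranacci numbers `E n = A n + B n + C n + D n`. -/
def E (n : ℕ) : ℕ := A n + B n + C n + D n

theorem used_eq (n : ℕ) :
    used n = (Finset.Icc 1 n).biUnion (fun i => {A i, B i, C i, D i, E i}) := by
  induction n with
  | zero => rfl
  | succ n ih =>
    rw [← Finset.insert_Icc_right_eq_Icc_add_one (by omega), Finset.biUnion_insert, ← ih,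
      Finset.union_comm]
    rfl

/-- The remainder sequences, for `n ≥ 1`. -/
def remA (n : ℕ) : ℤ := 17 * (n : ℤ) - 11 - 4 * (A n : ℤ)
def remB (n : ℕ) : ℤ := 17 * (n : ℤ) - 7 - 4 * (B n : ℤ)
def remC (n : ℕ) : ℤ := 17 * (n : ℤ) - 3 - 4 * (C n : ℤ)
def remD (n : ℕ) : ℤ := 17 * (n : ℤ) + 1 - 4 * (D n : ℤ)
def remE (n : ℕ) : ℤ := 17 * (n : ℤ) - 5 - (E n : ℤ)

end AntiTetranacci

/-- A family of sequences, each indexed by `n ≥ 1`, is complementary if every term is a positive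
integer and every positive integer occurs in exactly one of the sequences, at exactly one index. -/
def IsComplementary {ι : Type} (s : ι → ℕ → ℕ) : Prop :=
  Set.BijOn (fun p : ι × ℕ => s p.1 p.2) {p | 1 ≤ p.2} {m | 1 ≤ m}

/-- A sequence `f 0, f 1, …` is `k`-automatic if there is a finite automaton with output
(states `Q`, transition function `δ`, initial state `q₀`, output function `τ`) that outputs `f n`
on reading any base-`k` representation of `n`, least significant digit first, where zeros may be
appended at the most significant end. -/
def IsAutomatic (k : ℕ) {Δ : Type} (f : ℕ → Δ) : Prop :=
  ∃ (Q : Type) (_ : Finite Q) (δ : Q → Fin k → Q) (q₀ : Q) (τ : Q → Δ),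
    ∀ w : List (Fin k), f (Nat.ofDigits k (w.map Fin.val)) = τ (w.foldl δ q₀)

/-! ### Closed forms. -/

namespace AntiTetranacci

/-! Cut the positive integers into blocks 17q+1, …, 17q+17. Each block contains exactly one E-value,
at position 12 - r with r = `defect q`, 0 ≤ r ≤ 3; its other 16 members form four quadruples (A, B,
C, D). With m = 4q + k, the quadruple sums exceed 68q by 10, 26, 43 + r, 62 for k = 0, 1, 2, 3.
Comparing with 17m + 12 gives the base-4 recursion of `defect` (`sum_terms`). Each E-value is
produced before the mex reaches it, so the closed forms satisfy the mex recursion (`mem_used`). All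
remainders depend only on m mod 4 and `defect (m / 4)`, which yields bounds and automaticity. -/

/-- The remainder `17 n - 5 - E n` at `n = m + 1`. -/
def defect (m : ℕ) : ℕ :=
  if m % 4 = 0 then 2 else if m % 4 = 1 then 3 else
  if h : m % 4 = 2 then 3 - defect (m / 4) else 1
termination_by m
decreasing_by omega

theorem defect_le (m : ℕ) : defect m ≤ 3 := by
  unfold defect
  split_ifs <;> omega

/-- The closed form of the fifth sequence at index `m + 1`. -/
def sumTerm (m : ℕ) : ℕ := 17 * m + 12 - defect m

/-- Position of the `i`-th integer of `1, …, 17` that differs from `12 - r`. -/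
def offset (i r : ℕ) : ℕ := if i + 1 < 12 - r then i + 1 else i + 2

/-- The increasing enumeration of the positive integers that are not values of `sumTerm`. -/
def term (N : ℕ) : ℕ := 17 * (N / 16) + offset (N % 16) (defect (N / 16))

theorem term_zero : term 0 = 1 := by
  have := defect_le 0
  simp only [term, offset, Nat.zero_div, Nat.zero_mod]
  split_ifs <;> omega

/-- Both values determine their block of 17, and within a block `offset` skips position 12 - r. -/
theorem term_ne_sumTerm (N i : ℕ) : term N ≠ sumTerm i := by
  intro h
  have h1 := defect_le (N / 16)
  have h2 := defect_le i
  have hi : N / 16 = i := by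
    simp only [term, offset, sumTerm] at h
    split_ifs at h <;> omega
  subst hi
  simp only [term, offset, sumTerm] at h
  split_ifs at h <;> omega

theorem div_mod_succ (N : ℕ) :
    ((N + 1) / 16 = N / 16 ∧ (N + 1) % 16 = N % 16 + 1) ∨
      ((N + 1) / 16 = N / 16 + 1 ∧ (N + 1) % 16 = 0 ∧ N % 16 = 15) := by
  omega

theorem term_lt_succ (N : ℕ) : term N < term (N + 1) := by
  have h1 := defect_le (N / 16)
  have h2 := defect_le (N / 16 + 1)
  simp only [term, offset]
  rcases div_mod_succ N with ⟨h, h'⟩ | ⟨h, h', h''⟩ <;> rw [h, h'] <;> split_ifs <;> omega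

theorem term_strictMono : StrictMono term := strictMono_nat_of_lt_succ term_lt_succ

/-- The skipped position is at least 9, so at least 8 terms of its block precede it; hence the 7.
For N ≤ 4m + 3 this forces i < m: the skipped number is already used. -/
theorem eq_sumTerm_of_between {N y : ℕ} (h₁ : term N < y) (h₂ : y < term (N + 1)) :
    ∃ i, 16 * i + 7 ≤ N ∧ y = sumTerm i := by
  refine ⟨N / 16, ?_⟩
  have h1 := defect_le (N / 16)
  have h2 := defect_le (N / 16 + 1)
  have h3 := Nat.div_add_mod N 16
  simp only [term, offset, sumTerm] at *
  rcases div_mod_succ N with ⟨h, h'⟩ | ⟨h, h', h''⟩ <;> rw [h, h'] at h₂ <;>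
    split_ifs at h₁ h₂ <;> omega

theorem sum_terms (m : ℕ) :
    term (4 * m) + term (4 * m + 1) + term (4 * m + 2) + term (4 * m + 3) = sumTerm m := by
  have h1 := defect_le (m / 4)
  have e (l : ℕ) (hl : l < 4) : (4 * m + l) / 16 = m / 4 ∧ (4 * m + l) % 16 = 4 * (m % 4) + l := by
    omega
  have e0 := e 0 (by omega)
  have hm := Nat.div_add_mod m 4
  simp only [add_zero] at e0
  simp only [term, offset, sumTerm, e0, e 1 (by omega), e 2 (by omega), e 3 (by omega)]
  rw [defect.eq_1 m]
  have : m % 4 = 0 ∨ m % 4 = 1 ∨ m % 4 = 2 ∨ m % 4 = 3 := by omega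
  rcases this with h | h | h | h <;> simp only [h] at hm ⊢ <;> simp <;> split_ifs <;> omega

/-! ### The mex recursion. -/

theorem mex_eq {S : Finset ℕ} {x : ℕ} (h₀ : 0 < x) (h₁ : x ∉ S)
    (h₂ : ∀ y, 0 < y → y < x → y ∈ S) : mex S = x := by
  rw [mex, Nat.find_eq_iff]
  exact ⟨⟨h₀, h₁⟩, fun y hy h => h.2 (h₂ y h.1 hy)⟩

/-- Adjoining to the used terms the next `l ≤ 3` values of `term`, the mex is the value after. -/
theorem mex_eq_term {S : Finset ℕ} {m l : ℕ} (hl : l < 4)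
    (h : ∀ x, x ∈ S ↔ (0 < x ∧ x < term (4 * m)) ∨ (∃ i < m, x = sumTerm i) ∨
      ∃ k < l, x = term (4 * m + k)) : mex S = term (4 * m + l) := by
  have hpos : 0 < term (4 * m + l) := by
    have := term_strictMono.monotone (Nat.zero_le (4 * m + l))
    rw [term_zero] at this
    omega
  refine mex_eq hpos ?_ fun y hy hyl => ?_
  · rw [h]
    rintro (⟨-, hx⟩ | ⟨i, -, hx⟩ | ⟨k, hk, hx⟩)
    · have := term_strictMono.monotone (Nat.le_add_right (4 * m) l)
      omega
    · exact term_ne_sumTerm _ _ hx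
    · have := term_strictMono.injective hx
      omega
  · rw [h]
    clear h hpos
    induction l with
    | zero => exact Or.inl ⟨hy, hyl⟩
    | succ l ih =>
      rcases lt_trichotomy y (term (4 * m + l)) with hlt | heq | hgt
      · rcases ih (by omega) hlt with h | h | ⟨k, hk, h⟩
        · exact Or.inl h
        · exact Or.inr (Or.inl h)
        · exact Or.inr (Or.inr ⟨k, by omega, h⟩)
      · exact Or.inr (Or.inr ⟨l, by omega, heq⟩)
      · obtain ⟨i, hi, hyi⟩ := eq_sumTerm_of_between hgt hyl
        exact Or.inr (Or.inl ⟨i, by omega, hyi⟩)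

theorem nextA_eq {S : Finset ℕ} {m : ℕ}
    (h : ∀ x, x ∈ S ↔ (0 < x ∧ x < term (4 * m)) ∨ ∃ i < m, x = sumTerm i) :
    nextA S = term (4 * m) :=
  mex_eq_term (l := 0) (by omega) fun x => by simp [h]

theorem nextB_eq {S : Finset ℕ} {m : ℕ}
    (h : ∀ x, x ∈ S ↔ (0 < x ∧ x < term (4 * m)) ∨ ∃ i < m, x = sumTerm i) :
    nextB S = term (4 * m + 1) :=
  mex_eq_term (l := 1) (by omega) fun x => by
    simp only [Finset.mem_union, h, nextA_eq h, Finset.mem_singleton, Nat.exists_lt_succ_right,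
      Nat.not_lt_zero, false_and, exists_false, add_zero, false_or, or_assoc]

theorem nextC_eq {S : Finset ℕ} {m : ℕ}
    (h : ∀ x, x ∈ S ↔ (0 < x ∧ x < term (4 * m)) ∨ ∃ i < m, x = sumTerm i) :
    nextC S = term (4 * m + 2) :=
  mex_eq_term (l := 2) (by omega) fun x => by
    simp only [Finset.mem_union, h, nextA_eq h, nextB_eq h, Finset.mem_insert,
      Finset.mem_singleton, Nat.exists_lt_succ_right, Nat.not_lt_zero, false_and, exists_false,
      add_zero, false_or, or_assoc]

theorem nextD_eq {S : Finset ℕ} {m : ℕ}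
    (h : ∀ x, x ∈ S ↔ (0 < x ∧ x < term (4 * m)) ∨ ∃ i < m, x = sumTerm i) :
    nextD S = term (4 * m + 3) :=
  mex_eq_term (l := 3) (by omega) fun x => by
    simp only [Finset.mem_union, h, nextA_eq h, nextB_eq h, nextC_eq h, Finset.mem_insert,
      Finset.mem_singleton, Nat.exists_lt_succ_right, Nat.not_lt_zero, false_and, exists_false,
      add_zero, false_or, or_assoc]

theorem nextE_eq {S : Finset ℕ} {m : ℕ}
    (h : ∀ x, x ∈ S ↔ (0 < x ∧ x < term (4 * m)) ∨ ∃ i < m, x = sumTerm i) :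
    nextE S = sumTerm m := by
  rw [nextE, nextA_eq h, nextB_eq h, nextC_eq h, nextD_eq h, sum_terms]

/-- The induction invariant: it is the hypothesis under which the next five terms take their closed
forms. -/
theorem mem_used (m x : ℕ) :
    x ∈ used m ↔ (0 < x ∧ x < term (4 * m)) ∨ ∃ i < m, x = sumTerm i := by
  induction m generalizing x with
  | zero =>
    simp [used, term_zero]
    omega
  | succ m ih =>
    have t0 := term_strictMono.monotone (Nat.zero_le (4 * m))
    rw [term_zero] at t0
    have t1 := term_lt_succ (4 * m)
    have t2 : term (4 * m + 1) < term (4 * m + 2) := term_lt_succ _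
    have t3 : term (4 * m + 2) < term (4 * m + 3) := term_lt_succ _
    have t4 : term (4 * m + 3) < term (4 * m + 4) := term_lt_succ _
    simp only [used, Finset.mem_union, ih, nextA_eq ih, nextB_eq ih, nextC_eq ih, nextD_eq ih,
      nextE_eq ih, Finset.mem_insert, Finset.mem_singleton, mul_add, mul_one]
    constructor
    · rintro ((⟨h, h'⟩ | ⟨i, hi, h⟩) | h | h | h | h | h)
      · exact Or.inl ⟨h, by omega⟩
      · exact Or.inr ⟨i, by omega, h⟩
      iterate 4 exact Or.inl (by omega)
      · exact Or.inr ⟨m, by omega, h⟩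
    · rintro (⟨h, h'⟩ | ⟨i, hi, h⟩)
      · by_contra! hc
        obtain ⟨⟨c1, c2⟩, c3, c4, c5, c6, -⟩ := hc
        have key (l : ℕ) (hl : l < 4) (p : term (4 * m + l) < x) :
            term (4 * m + (l + 1)) ≤ x := by
          by_contra! q
          obtain ⟨i, hi, hx⟩ := eq_sumTerm_of_between p q
          exact c2 i (by omega) hx
        have k0 : term (4 * m) < x → term (4 * m + 1) ≤ x := key 0 (by omega)
        have k1 : term (4 * m + 1) < x → term (4 * m + 2) ≤ x := key 1 (by omega)
        have k2 : term (4 * m + 2) < x → term (4 * m + 3) ≤ x := key 2 (by omega)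
        have k3 : term (4 * m + 3) < x → term (4 * m + 4) ≤ x := key 3 (by omega)
        have c1' := c1 h
        omega
      · rcases Nat.lt_succ_iff_lt_or_eq.1 hi with hi | rfl
        · exact Or.inl (Or.inr ⟨i, hi, h⟩)
        · simp [h]

theorem A_succ (m : ℕ) : A (m + 1) = term (4 * m) := nextA_eq (mem_used m)
theorem B_succ (m : ℕ) : B (m + 1) = term (4 * m + 1) := nextB_eq (mem_used m)
theorem C_succ (m : ℕ) : C (m + 1) = term (4 * m + 2) := nextC_eq (mem_used m)
theorem D_succ (m : ℕ) : D (m + 1) = term (4 * m + 3) := nextD_eq (mem_used m)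
theorem E_succ (m : ℕ) : E (m + 1) = sumTerm m := nextE_eq (mem_used m)

/-! ### Complementarity. -/

theorem isComplementary : IsComplementary ![A, B, C, D, E] := by
  have hval (j : Fin 5) (m : ℕ) : (![A, B, C, D, E] : Fin 5 → ℕ → ℕ) j (m + 1) =
      if j = 4 then sumTerm m else term (4 * m + j) := by
    fin_cases j <;> simp [A_succ, B_succ, C_succ, D_succ, E_succ]
  have ht (N : ℕ) : N < term N := by
    induction N with
    | zero => simp [term_zero]
    | succ N ih =>
      have := term_lt_succ N
      omega
  refine ⟨?_, ?_, ?_⟩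
  · rintro ⟨j, n⟩ hn
    obtain ⟨m, rfl⟩ : ∃ m, n = m + 1 := ⟨n - 1, by simp at hn; omega⟩
    simp only [hval, Set.mem_ofPred_eq]
    split_ifs
    · have := defect_le m
      rw [sumTerm]
      omega
    · have := ht (4 * m + j)
      omega
  · rintro ⟨j, n⟩ hn ⟨j', n'⟩ hn' h
    obtain ⟨m, rfl⟩ : ∃ m, n = m + 1 := ⟨n - 1, by simp at hn; omega⟩
    obtain ⟨m', rfl⟩ : ∃ m, n' = m + 1 := ⟨n' - 1, by simp at hn'; omega⟩
    simp only [hval] at h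
    split_ifs at h with h1 h2 h2
    · have := defect_le m
      have := defect_le m'
      rw [sumTerm, sumTerm] at h
      have : m = m' := by omega
      simp [h1, h2, this]
    · exact absurd h.symm (term_ne_sumTerm _ _)
    · exact absurd h (term_ne_sumTerm _ _)
    · have := term_strictMono.injective h
      have : m = m' := by omega
      have : j = j' := by omega
      simp [*]
  · intro x hx
    -- Surjectivity: x ≤ 4x < `term (4 * x)`, so x is used within the first x rounds.
    have hmem : x ∈ used x := (mem_used x x).2 (Or.inl ⟨hx, by have := ht (4 * x); omega⟩)
    simp only [used_eq, Finset.mem_biUnion, Finset.mem_insert, Finset.mem_singleton,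
      Finset.mem_Icc] at hmem
    obtain ⟨i, ⟨hi, -⟩, h | h | h | h | h⟩ := hmem
    · exact ⟨(0, i), hi, h.symm⟩
    · exact ⟨(1, i), hi, h.symm⟩
    · exact ⟨(2, i), hi, h.symm⟩
    · exact ⟨(3, i), hi, h.symm⟩
    · exact ⟨(4, i), hi, h.symm⟩

/-! ### Remainders and their bounds. -/

/-- The remainders of the first four sequences, with `c = 6, 10, 14, 18` for `l = 0, 1, 2, 3`. -/
theorem term_remainder (m l : ℕ) (hl : l < 4) (c : ℤ) :
    17 * (m : ℤ) + c - 4 * (term (4 * m + l) : ℤ) =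
      17 * ((m % 4 : ℕ) : ℤ) + c - 4 * (offset (4 * (m % 4) + l) (defect (m / 4)) : ℤ) := by
  have e : (4 * m + l) / 16 = m / 4 ∧ (4 * m + l) % 16 = 4 * (m % 4) + l := by omega
  rw [term, e.1, e.2]
  omega

theorem remA_succ (m : ℕ) : remA (m + 1) =
    17 * ((m % 4 : ℕ) : ℤ) + 6 - 4 * (offset (4 * (m % 4)) (defect (m / 4)) : ℤ) := by
  rw [remA, A_succ, ← add_zero (4 * m), ← add_zero (4 * (m % 4)),
    ← term_remainder m 0 (by omega) 6]
  push_cast; ring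

theorem remB_succ (m : ℕ) : remB (m + 1) =
    17 * ((m % 4 : ℕ) : ℤ) + 10 - 4 * (offset (4 * (m % 4) + 1) (defect (m / 4)) : ℤ) := by
  rw [remB, B_succ, ← term_remainder m 1 (by omega) 10]
  push_cast; ring

theorem remC_succ (m : ℕ) : remC (m + 1) =
    17 * ((m % 4 : ℕ) : ℤ) + 14 - 4 * (offset (4 * (m % 4) + 2) (defect (m / 4)) : ℤ) := by
  rw [remC, C_succ, ← term_remainder m 2 (by omega) 14]
  push_cast; ring

theorem remD_succ (m : ℕ) : remD (m + 1) =
    17 * ((m % 4 : ℕ) : ℤ) + 18 - 4 * (offset (4 * (m % 4) + 3) (defect (m / 4)) : ℤ) := by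
  rw [remD, D_succ, ← term_remainder m 3 (by omega) 18]
  push_cast; ring

theorem remE_succ (m : ℕ) : remE (m + 1) = defect m := by
  have := defect_le m
  rw [remE, E_succ, sumTerm]
  omega

theorem remainder_bounds (m : ℕ) :
    (0 ≤ remA (m + 1) ∧ remA (m + 1) ≤ 4) ∧ (0 ≤ remB (m + 1) ∧ remB (m + 1) ≤ 4) ∧
    (0 ≤ remC (m + 1) ∧ remC (m + 1) ≤ 4) ∧ (0 ≤ remD (m + 1) ∧ remD (m + 1) ≤ 3) ∧
    (0 ≤ remE (m + 1) ∧ remE (m + 1) ≤ 3) := by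
  have h1 := defect_le (m / 4)
  have h2 := defect_le m
  have h3 : m % 4 < 4 := Nat.mod_lt _ (by omega)
  rw [remA_succ, remB_succ, remC_succ, remD_succ, remE_succ]
  generalize defect (m / 4) = r at *
  generalize m % 4 = k at *
  refine ⟨?_, ?_, ?_, ?_, by omega⟩ <;> interval_cases k <;> interval_cases r <;> decide

theorem exists_remC_eq_four : ∃ n, 1 ≤ n ∧ remC n = 4 := by
  have h1 : defect 1 = 3 := by rw [defect]; rfl
  have h6 : defect 6 = 0 := by rw [defect]; simp [h1]
  -- Here m = 26 = 4 · 6 + 2, and `defect 6 = 0` puts the skipped position at 12, just after C.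
  refine ⟨27, by omega, ?_⟩
  rw [remC_succ]
  norm_num [h6, offset]

end AntiTetranacci

/-! ### Automaticity. -/

/-- A family of sequences indexed by a finite set and closed under the `k`-kernel operations
consists of `k`-automatic sequences. -/
theorem IsAutomatic.of_kernel {k : ℕ} {Δ Q : Type} [Finite Q] (f : Q → ℕ → Δ) (δ : Q → Fin k → Q)
    (h : ∀ q (b : Fin k) n, f q (b + k * n) = f (δ q b) n) (q : Q) : IsAutomatic k (f q) := by
  refine ⟨Q, inferInstance, δ, q, fun q => f q 0, fun w => ?_⟩
  induction w generalizing q with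
  | nil => rfl
  | cons b w ih => rw [List.map_cons, Nat.ofDigits_cons, h, ih, List.foldl_cons]

theorem IsAutomatic.comp {k : ℕ} {Δ Δ' : Type} {f : ℕ → Δ} (hf : IsAutomatic k f) (g : Δ → Δ') :
    IsAutomatic k (fun n => g (f n)) := by
  obtain ⟨Q, hQ, δ, q₀, τ, h⟩ := hf
  exact ⟨Q, hQ, δ, q₀, fun q => g (τ q), fun w => congrArg g (h w)⟩

namespace AntiTetranacci

/-- `defect m` as an element of `Fin 4`. -/
def finDefect (m : ℕ) : Fin 4 := ⟨defect m, Nat.lt_succ_of_le (defect_le m)⟩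

/-- The value of `finDefect (4 * j + i)` in terms of `x = finDefect j`. -/
def defectStep (i : ℕ) (x : Fin 4) : Fin 4 :=
  if i = 0 then 2 else if i = 1 then 3 else if i = 2 then Fin.rev x else 1

theorem finDefect_eq (m : ℕ) : finDefect m = defectStep (m % 4) (finDefect (m / 4)) := by
  have hd := defect.eq_1 m
  have : m % 4 < 4 := Nat.mod_lt _ (by omega)
  apply Fin.ext
  simp only [finDefect, defectStep]
  split_ifs at hd ⊢ <;> simp [hd, Fin.val_rev]

/-- Digits `m % 4` with `defect (m / 4)` form a `2`-automatic sequence. -/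
theorem isAutomatic_pair :
    IsAutomatic 2 (fun m => ((⟨m % 4, Nat.mod_lt _ (by omega)⟩, finDefect (m / 4)) :
      Fin 4 × Fin 4)) := by
  let P := Fin 4 × Fin 4
  -- A state is the function still to be applied to the unread digits: before the first base-4
  -- digit, halfway through a base-4 digit, or at a later base-4 boundary.
  let Q := (Fin 4 → Fin 4 → P) ⊕ (Fin 2 → Fin 4 → P) ⊕ (Fin 4 → P)
  let f : Q → ℕ → P
    | .inl G, m => G (Fin.ofNat 4 m) (finDefect (m / 4))
    | .inr (.inl G), m => G (Fin.ofNat 2 m) (finDefect (m / 2))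
    | .inr (.inr g), m => g (finDefect m)
  let δ : Q → Fin 2 → Q
    | .inl G, b => .inr (.inl fun c => G (Fin.ofNat 4 (b + 2 * c)))
    | .inr (.inl G), b => .inr (.inr (G b))
    | .inr (.inr g), b => .inr (.inl fun c x => g (defectStep (b + 2 * c) x))
  refine IsAutomatic.of_kernel f δ ?_ (.inl Prod.mk)
  rintro (G | G | g) b n
  · have h1 : (b + 2 * n) / 4 = n / 2 := by omega
    have h2 : Fin.ofNat 4 (b + 2 * n) = Fin.ofNat 4 (b + 2 * (Fin.ofNat 2 n : Fin 2)) := by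
      apply Fin.ext
      simp only [Fin.ofNat]
      omega
    simp only [f, δ, h1, h2]
  · have h1 : (b + 2 * n) / 2 = n := by omega
    have h2 : Fin.ofNat 2 (b + 2 * n) = b := by
      apply Fin.ext
      simp only [Fin.ofNat]
      omega
    simp only [f, δ, h1, h2]
  · have h1 : (b + 2 * n) / 4 = n / 2 := by omega
    have h2 : (b + 2 * n) % 4 = b + 2 * (Fin.ofNat 2 n : Fin 2) := by
      simp only [Fin.ofNat]
      omega
    simp only [f, δ]
    rw [finDefect_eq, h1, h2]

theorem isAutomatic_of_eq {f : ℕ → ℤ} (g : ℕ → ℕ → ℤ)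
    (h : ∀ m, f m = g (m % 4) (defect (m / 4))) : IsAutomatic 2 f := by
  rw [funext h]
  exact isAutomatic_pair.comp fun p => g p.1 p.2

end AntiTetranacci

theorem mainTheorem5 :
    IsComplementary ![AntiTetranacci.A, AntiTetranacci.B, AntiTetranacci.C, AntiTetranacci.D, AntiTetranacci.E] ∧
    (∀ n : ℕ, 1 ≤ n →
      (0 ≤ AntiTetranacci.remA n ∧ AntiTetranacci.remA n ≤ 4) ∧
      (0 ≤ AntiTetranacci.remB n ∧ AntiTetranacci.remB n ≤ 4) ∧
      (0 ≤ AntiTetranacci.remC n ∧ AntiTetranacci.remC n ≤ 4) ∧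
      (0 ≤ AntiTetranacci.remD n ∧ AntiTetranacci.remD n ≤ 3) ∧
      (0 ≤ AntiTetranacci.remE n ∧ AntiTetranacci.remE n ≤ 3)) ∧
    (∃ n : ℕ, 1 ≤ n ∧ AntiTetranacci.remC n = 4) ∧
    IsAutomatic 2 (fun n => AntiTetranacci.remA (n + 1)) ∧
    IsAutomatic 2 (fun n => AntiTetranacci.remB (n + 1)) ∧
    IsAutomatic 2 (fun n => AntiTetranacci.remC (n + 1)) ∧
    IsAutomatic 2 (fun n => AntiTetranacci.remD (n + 1)) ∧
    IsAutomatic 2 (fun n => AntiTetranacci.remE (n + 1)) := by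
  refine ⟨AntiTetranacci.isComplementary, fun n hn => ?_, AntiTetranacci.exists_remC_eq_four,
    AntiTetranacci.isAutomatic_of_eq
      (fun i r => 17 * (i : ℤ) + 6 - 4 * (AntiTetranacci.offset (4 * i) r : ℤ))
      AntiTetranacci.remA_succ,
    AntiTetranacci.isAutomatic_of_eq
      (fun i r => 17 * (i : ℤ) + 10 - 4 * (AntiTetranacci.offset (4 * i + 1) r : ℤ))
      AntiTetranacci.remB_succ,
    AntiTetranacci.isAutomatic_of_eq
      (fun i r => 17 * (i : ℤ) + 14 - 4 * (AntiTetranacci.offset (4 * i + 2) r : ℤ))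
      AntiTetranacci.remC_succ,
    AntiTetranacci.isAutomatic_of_eq
      (fun i r => 17 * (i : ℤ) + 18 - 4 * (AntiTetranacci.offset (4 * i + 3) r : ℤ))
      AntiTetranacci.remD_succ,
    AntiTetranacci.isAutomatic_of_eq
      (fun i r => if i = 0 then 2 else if i = 1 then 3 else if i = 2 then (3 - r : ℕ) else 1)
      fun m => ?_⟩
  · obtain ⟨m, rfl⟩ := Nat.exists_eq_add_of_le' hn
    exact AntiTetranacci.remainder_bounds m
  · rw [AntiTetranacci.remE_succ, AntiTetranacci.defect]
    split_ifs <;> rfl
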